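/- Let $H=\langle V,E\rangle$ be a finite, connected, simple graph with $N=|V|$ vertices and maximum degree $\delta\ge 3$. Let $\widehat H$ be its regularisation: to each vertex $v$ attach $\delta-\deg(v)$ loops, each loop increasing the degree of $v$ by one, so that $\widehat H$ is $\delta$-regular. Let $A$ be the transition matrix of the simple random walk on $\widehat H$, that is, $A_{kl}=1/\delta$ if $\{k,l\}\in E$, $A_{kk}=(\delta-\deg(k))/\delta$, and $A_{kl}=0$ otherwise. The continuous-time regularised random walk $\widehat X_t$ on $H$ has the transition probabilities $$\mathbb P^k[\widehat X_t=l]=\sum_{n=0}^\infty e^{-t}\frac{t^n}{n!}(A^n)_{kl}\qquad(k,l\in V,\ t\ge 0),$$ and its average return probability is its return probability under the uniform initial distribution, $\mathbb P_-[\widehat X_t=\widehat X_0]=\frac1N\sum_{k\in V}\mathbb P^k[\widehat X_t=k]$. Put $$\nu=\frac{1}{(\delta-1)\ln 16},\qquad a=1+\frac{\sqrt{\pi\delta}}{2^{1-\nu}}.$$ Then for every real $t$ with $4^{1+\nu}N^{1-\nu}\le t\le 4^{-(1+\nu)^2/\nu}N^4$, $$\mathbb P_-[\widehat X_t=\widehat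 X_0]\;\le\;\frac1N+a\left(\frac{N^{1-\nu}}{\sqrt t}\right)^{\frac1{1+\nu}}e^{-4t/(\delta N^2)}.$$ -/

import Mathlib

noncomputable section

namespace RRW

variable {V : Type*} [Fintype V] [DecidableEq V]

/-- The regularisation with loops of a finite simple graph `G`, as the matrix of edge
multiplicities: the edges of `G` are kept, and the vertex `v` receives `δ - deg v` loops,
where `δ` is the maximum degree of `G`. -/
def regularisation (G : SimpleGraph V) [DecidableRel G.Adj] : Matrix V V ℕ :=
  Matrix.of fun k l =>
    if k = l then G.maxDegree - G.degree k else if G.Adj k l then 1 else 0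

/-- The degree of a vertex of a multigraph with edge multiplicities `m`; every loop counts one. -/
def multiDegree (m : Matrix V V ℕ) (k : V) : ℕ := ∑ l, m k l

/-- The transition matrix of the simple random walk on a multigraph with edge multiplicities `m`:
from `k` the walk leaves along one of the `multiDegree m k` edges at `k`, chosen uniformly. -/
def srwMatrix (m : Matrix V V ℕ) : Matrix V V ℝ :=
  Matrix.of fun k l => (m k l : ℝ) / (multiDegree m k : ℝ)

/-- The transition matrix of the regularised random walk on `G`: the simple random walk on the
regularisation of `G`. -/
def transition (G : SimpleGraph V) [DecidableRel G.Adj] : Matrix V V ℝ :=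
  srwMatrix (regularisation G)

/-- The probability that the continuous-time walk with discrete-time transition matrix `A`,
started in `k`, is in `l` at time `t`: the walk makes `n` independent steps during `[0, t]`
with probability `e^{-t} t ^ n / n!`. -/
def contTimeProb (A : Matrix V V ℝ) (t : ℝ) (k l : V) : ℝ :=
  ∑' n : ℕ, Real.exp (-t) * t ^ n / (n.factorial : ℝ) * (A ^ n) k l

/-- The average return probability at time `t` of the continuous-time regularised random walk
on `G`: the probability of being in the initial state at time `t`, when the initial state is
uniformly distributed on the vertex set. -/
def averageReturnProb (G : SimpleGraph V) [DecidableRel G.Adj] (t : ℝ) : ℝ :=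
  ∑ k : V, (1 / (Fintype.card V : ℝ)) * contTimeProb (transition G) t k k

/-- The regularisation is regular, of degree the maximum degree of `G`. -/
theorem multiDegree_regularisation (G : SimpleGraph V) [DecidableRel G.Adj] (k : V) :
    multiDegree (regularisation G) k = G.maxDegree := by
  have h1 : ∀ l, regularisation G k l
      = (if k = l then G.maxDegree - G.degree k else 0) + (if G.Adj k l then 1 else 0) := by
    intro l
    by_cases h : k = l
    · subst h
      simp [regularisation]
    · simp [regularisation, h]
  have h2 : ∑ l, (if G.Adj k l then 1 else 0) = G.degree k := by
    rw [← SimpleGraph.card_neighborFinset_eq_degree, SimpleGraph.neighborFinset_eq_filter,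
      Finset.card_filter]
  simp only [multiDegree, h1, Finset.sum_add_distrib, h2, Finset.sum_ite_eq, Finset.mem_univ,
    if_true]
  exact Nat.sub_add_cancel (G.degree_le_maxDegree k)

/-- The step probabilities of the regularised random walk sum up to one. -/
theorem transition_mem (G : SimpleGraph V) [DecidableRel G.Adj] (hG : 0 < G.maxDegree) :
    transition G ∈ Matrix.rowStochastic ℝ V := by
  rw [Matrix.mem_rowStochastic_iff_sum]
  refine ⟨fun k l => by simp only [transition, srwMatrix, Matrix.of_apply]; positivity,
    fun k => ?_⟩
  simp only [transition, srwMatrix, Matrix.of_apply]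
  rw [← Finset.sum_div, multiDegree_regularisation, div_eq_one_iff_eq (by positivity),
    ← multiDegree_regularisation G k]
  simp [multiDegree]

/-- The series defining the continuous-time transition probabilities converges. -/
theorem summable_contTimeProb {A : Matrix V V ℝ} (hA : A ∈ Matrix.rowStochastic ℝ V)
    (t : ℝ) (k l : V) :
    Summable fun n : ℕ => Real.exp (-t) * t ^ n / (n.factorial : ℝ) * (A ^ n) k l := by
  have hp := fun n => Matrix.mem_rowStochastic_iff_sum.1 (pow_mem hA n)
  have hle : ∀ n, (A ^ n) k l ≤ 1 := fun n =>
    (Finset.single_le_sum (fun j _ => (hp n).1 k j) (Finset.mem_univ l)).trans ((hp n).2 k).le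
  refine Summable.of_norm_bounded ((Real.summable_pow_div_factorial |t|).mul_left
    (Real.exp (-t))) fun n => ?_
  rw [norm_mul, Real.norm_eq_abs, Real.norm_eq_abs, abs_of_nonneg ((hp n).1 k l), abs_div,
    abs_mul, abs_pow, Real.abs_exp, Nat.abs_cast, ← mul_div_assoc]
  exact mul_le_of_le_one_right (by positivity) (hle n)

end RRW

end

/-! The transition matrix is symmetric, so the average return probability is a normalised trace,
`(1/N) ∑ exp (-t (1 - λ_k))`, with `λ_0 ≥ λ_1 ≥ ...`. It suffices to bound the eigenvalues from
above. By min-max, a Poincaré inequality valid under `k` linear constraints bounds `λ_k`.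

Two such inequalities are used for `k ≥ 1`. Sorting the vertices by the values of `f` compares the
graph with a path and gives `1 - λ_k ≥ 4 / (δ N²)`. A tour of fewer than `2N` points through all
vertices, with `f` set to zero at `k` equally spaced times, gives `1 - λ_k ≥ k² / (9 δ N²)`.

The gap serves for `k ≤ 6`, the quadratic bound beyond. A Gaussian integral then yields `1/N` plus
`exp (-4t / (δ N²))` times a combination of `1/N` and `1/√t`. In the given range of times both are
absorbed by the power of `N^(1-ν) / √t` in the claim. -/

open Matrix in
/-- A linear constraint of codimension at most `k` bounds the `k`-th largest eigenvalue. -/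
theorem Matrix.IsHermitian.eigenvalues₀_le_of_ker {V : Type*} [Fintype V] [DecidableEq V]
    {A : Matrix V V ℝ} (hA : A.IsHermitian) (k : Fin (Fintype.card V))
    (W : (V → ℝ) →ₗ[ℝ] (Fin k → ℝ)) (c : ℝ)
    (h : ∀ f, W f = 0 → f ⬝ᵥ A *ᵥ f ≤ c * (f ⬝ᵥ f)) : hA.eigenvalues₀ k ≤ c := by
  let e : Fin (Fintype.card V) ≃ V := Fintype.equivOfCardEq (Fintype.card_fin _)
  let b : Fin (Fintype.card V) → V → ℝ := fun i => hA.eigenvectorBasis (e i)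
  have hAb : ∀ i, A *ᵥ b i = hA.eigenvalues₀ i • b i := fun i => by
    simpa [b, IsHermitian.eigenvalues, e] using hA.mulVec_eigenvectorBasis (e i)
  have hbb : ∀ i j, b i ⬝ᵥ b j = if i = j then 1 else 0 := fun i j => by
    have := orthonormal_iff_ite.1 hA.eigenvectorBasis.orthonormal (e j) (e i)
    rw [EuclideanSpace.inner_eq_star_dotProduct] at this
    simpa [b, eq_comm] using this
  let ι : Fin (k + 1) → Fin (Fintype.card V) := Fin.castLE k.2
  have hι : Function.Injective ι := Fin.castLE_injective _
  let T : (Fin (k + 1) → ℝ) →ₗ[ℝ] (V → ℝ) := Fintype.linearCombination ℝ (b ∘ ι)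
  have hT : ∀ x, T x = ∑ i, x i • b (ι i) := fun x => rfl
  obtain ⟨x, hx, hx0⟩ := (Submodule.ne_bot_iff _).1
    (LinearMap.ker_ne_bot_of_finrank_lt (f := W ∘ₗ T) (by simp))
  have hff : T x ⬝ᵥ T x = ∑ i, x i ^ 2 := by
    simp [hT, dotProduct_sum, sum_dotProduct, hbb, hι.eq_iff, sq]
  have hfA : T x ⬝ᵥ A *ᵥ T x = ∑ i, hA.eigenvalues₀ (ι i) * x i ^ 2 := by
    simp only [hT, mulVec_sum, mulVec_smul, hAb, dotProduct_sum, sum_dotProduct, smul_dotProduct,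
      dotProduct_smul, hbb, hι.eq_iff, smul_eq_mul, mul_ite, mul_one, mul_zero,
      Finset.sum_ite_eq', Finset.mem_univ, if_true]
    exact Finset.sum_congr rfl fun i _ => by ring
  have hpos : 0 < ∑ i, x i ^ 2 := by
    obtain ⟨i, hi⟩ := Function.ne_iff.1 hx0
    exact Finset.sum_pos' (fun i _ => sq_nonneg _) ⟨i, Finset.mem_univ _, by
      have : x i ≠ 0 := hi
      positivity⟩
  have h1 := h (T x) (by simpa using hx)
  have h2 : hA.eigenvalues₀ k * ∑ i, x i ^ 2 ≤ ∑ i, hA.eigenvalues₀ (ι i) * x i ^ 2 := by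
    rw [Finset.mul_sum]
    refine Finset.sum_le_sum fun i _ => mul_le_mul_of_nonneg_right ?_ (sq_nonneg _)
    exact hA.eigenvalues₀_antitone (Fin.le_def.2 (Nat.lt_succ_iff.1 i.2))
  rw [hff, hfA] at h1
  exact le_of_mul_le_mul_right (h2.trans h1) hpos

open Matrix in
theorem Matrix.IsHermitian.trace_pow_eq_sum_eigenvalues₀ {V : Type*} [Fintype V] [DecidableEq V]
    {A : Matrix V V ℝ} (hA : A.IsHermitian) (n : ℕ) :
    (A ^ n).trace = ∑ i, hA.eigenvalues₀ i ^ n := by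
  conv_lhs => rw [hA.spectral_theorem]
  rw [← map_pow, Unitary.conjStarAlgAut_apply, trace_mul_comm, ← mul_assoc,
    Unitary.coe_star_mul_self, one_mul, diagonal_pow, trace_diagonal]
  simp only [IsHermitian.eigenvalues, Function.comp_apply, Pi.pow_apply, RCLike.ofReal_real_eq_id, id]
  exact Equiv.sum_comp (Fintype.equivOfCardEq (Fintype.card_fin _)).symm
    (fun i => hA.eigenvalues₀ i ^ n)

/-! ### Spectral formula and Dirichlet form. -/

namespace RRW

variable {V : Type*} [Fintype V] [DecidableEq V]

/-- The average return probability in terms of the spectrum of the transition matrix. -/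
theorem averageReturnProb_eq_sum_exp (G : SimpleGraph V) [DecidableRel G.Adj]
    (hG : 0 < G.maxDegree) (hA : (transition G).IsHermitian) (t : ℝ) :
    averageReturnProb G t =
      1 / (Fintype.card V : ℝ) * ∑ i, Real.exp (-(t * (1 - hA.eigenvalues₀ i))) := by
  have h1 : HasSum (fun n : ℕ => ∑ k, Real.exp (-t) * t ^ n / (n.factorial : ℝ) *
      (transition G ^ n) k k) (∑ k, contTimeProb (transition G) t k k) :=
    hasSum_sum fun k _ => (summable_contTimeProb (transition_mem G hG) t k k).hasSum
  have h2 : HasSum (fun n : ℕ => ∑ i, Real.exp (-t) * t ^ n / (n.factorial : ℝ) *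
      hA.eigenvalues₀ i ^ n) (∑ i, Real.exp (-(t * (1 - hA.eigenvalues₀ i)))) := by
    refine hasSum_sum fun i _ => ?_
    have := (NormedSpace.expSeries_div_hasSum_exp (t * hA.eigenvalues₀ i)).mul_left (Real.exp (-t))
    rw [← Real.exp_eq_exp_ℝ, ← Real.exp_add] at this
    convert! this using 2
    · rw [mul_pow]; ring
    · ring
  have h3 : ∀ n : ℕ, ∑ k, Real.exp (-t) * t ^ n / (n.factorial : ℝ) * (transition G ^ n) k k =
      ∑ i, Real.exp (-t) * t ^ n / (n.factorial : ℝ) * hA.eigenvalues₀ i ^ n := fun n => by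
    rw [← Finset.mul_sum, ← Finset.mul_sum, ← hA.trace_pow_eq_sum_eigenvalues₀]
    rfl
  simp only [h3] at h1
  rw [averageReturnProb, ← Finset.mul_sum, h1.unique h2]

theorem transition_eq (G : SimpleGraph V) [DecidableRel G.Adj] (hG : 0 < G.maxDegree) :
    transition G = 1 - (1 / (G.maxDegree : ℝ)) • G.lapMatrix ℝ := by
  have h0 : (G.maxDegree : ℝ) ≠ 0 := by positivity
  ext k l
  have ht : transition G k l = (regularisation G k l : ℝ) / G.maxDegree := by
    simp [transition, srwMatrix, multiDegree_regularisation]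
  rw [ht]
  by_cases h : k = l
  · subst h
    simp [regularisation, SimpleGraph.lapMatrix, SimpleGraph.degMatrix, Nat.cast_sub (G.degree_le_maxDegree k)]
    field_simp
  · by_cases h' : G.Adj k l <;>
    simp [regularisation, SimpleGraph.lapMatrix, SimpleGraph.degMatrix, h, h']

theorem isHermitian_transition (G : SimpleGraph V) [DecidableRel G.Adj] (hG : 0 < G.maxDegree) :
    (transition G).IsHermitian := by
  rw [transition_eq G hG]
  exact Matrix.isHermitian_one.sub ((G.isHermitian_lapMatrix ℝ).smul (IsSelfAdjoint.all _))

/-- Twice the Dirichlet energy of `f`: every edge is counted in both directions. -/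
def energy (G : SimpleGraph V) [DecidableRel G.Adj] (f : V → ℝ) : ℝ :=
  ∑ i, ∑ j, if G.Adj i j then (f i - f j) ^ 2 else 0

open Matrix in
theorem dotProduct_transition (G : SimpleGraph V) [DecidableRel G.Adj] (hG : 0 < G.maxDegree)
    (f : V → ℝ) :
    f ⬝ᵥ transition G *ᵥ f = f ⬝ᵥ f - energy G f / (2 * G.maxDegree) := by
  have := G.lapMatrix_toLinearMap₂' ℝ f
  rw [toLinearMap₂'_apply'] at this
  rw [transition_eq G hG, sub_mulVec, dotProduct_sub, one_mulVec, smul_mulVec, dotProduct_smul,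
    this, energy, smul_eq_mul]
  congr 1
  field_simp

theorem eigenvalues₀_le_of_energy (G : SimpleGraph V) [DecidableRel G.Adj] (hG : 0 < G.maxDegree)
    (k : Fin (Fintype.card V)) (W : (V → ℝ) →ₗ[ℝ] (Fin k → ℝ)) (c : ℝ)
    (h : ∀ f, W f = 0 → 2 * c * ∑ v, f v ^ 2 ≤ energy G f) :
    (isHermitian_transition G hG).eigenvalues₀ k ≤ 1 - c / G.maxDegree := by
  refine (isHermitian_transition G hG).eigenvalues₀_le_of_ker k W _ fun f hf => ?_
  have h0 : (0 : ℝ) < G.maxDegree := by exact_mod_cast hG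
  have h1 : f ⬝ᵥ f = ∑ v, f v ^ 2 := by simp [dotProduct, sq]
  rw [dotProduct_transition G hG, h1, sub_mul, one_mul]
  have := h f hf
  have h2 : c / G.maxDegree * ∑ v, f v ^ 2 = (2 * c * ∑ v, f v ^ 2) / (2 * G.maxDegree) := by
    field_simp
  rw [h2]
  gcongr

end RRW

/-! ### Path inequalities, rearrangement and the spectral gap. -/

namespace RRW

/-- Poincaré inequality on a path for functions vanishing at the starting point. -/
theorem sum_sq_le_of_eq_zero (g : ℕ → ℝ) (h0 : g 0 = 0) (n : ℕ) :
    ∑ p ∈ Finset.range (n + 1), g p ^ 2 ≤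
      (n : ℝ) * (n + 1) / 2 * ∑ p ∈ Finset.range n, (g (p + 1) - g p) ^ 2 := by
  set S := ∑ p ∈ Finset.range n, (g (p + 1) - g p) ^ 2 with hS
  have h1 : ∀ p ∈ Finset.range (n + 1), g p ^ 2 ≤ p * S := fun p hp => by
    have h2 : g p = ∑ j ∈ Finset.range p, (g (j + 1) - g j) := by
      rw [Finset.sum_range_sub, h0, sub_zero]
    rw [h2]
    refine sq_sum_le_card_mul_sum_sq.trans ?_
    rw [Finset.card_range]
    refine mul_le_mul_of_nonneg_left ?_ (Nat.cast_nonneg p)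
    exact Finset.sum_le_sum_of_subset_of_nonneg
      (Finset.range_mono (Nat.lt_succ_iff.1 (Finset.mem_range.1 hp))) fun _ _ _ => sq_nonneg _
  refine (Finset.sum_le_sum h1).trans ?_
  rw [← Finset.sum_mul]
  have h3 : ∑ p ∈ Finset.range (n + 1), (p : ℝ) = (n : ℝ) * (n + 1) / 2 := by
    clear_value S
    clear hS h1 h0
    induction n with
    | zero => simp
    | succ n ih => rw [Finset.sum_range_succ, ih]; push_cast; ring
  rw [h3]

/-- Poincaré inequality on a path for functions vanishing at an interior point. -/
theorem sum_sq_sub_le (g : ℕ → ℝ) (m r : ℕ) (K : ℝ) (hm : (m : ℝ) * (m + 1) / 2 ≤ K)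
    (hr : (r : ℝ) * (r + 1) / 2 ≤ K) :
    ∑ p ∈ Finset.range (m + r + 1), (g p - g m) ^ 2 ≤
      K * ∑ p ∈ Finset.range (m + r), (g (p + 1) - g p) ^ 2 := by
  have hl := sum_sq_le_of_eq_zero (fun p => g (m - p) - g m) (by simp) m
  have hr' := sum_sq_le_of_eq_zero (fun p => g (m + p) - g m) (by simp) r
  have e1 : ∑ p ∈ Finset.range (m + 1), (g (m - p) - g m) ^ 2 =
      ∑ p ∈ Finset.range (m + 1), (g p - g m) ^ 2 := by
    rw [← Finset.sum_range_reflect (fun p => (g p - g m) ^ 2)]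
    simp
  have e2 : ∑ p ∈ Finset.range m, (g (m - (p + 1)) - g m - (g (m - p) - g m)) ^ 2 =
      ∑ p ∈ Finset.range m, (g (p + 1) - g p) ^ 2 := by
    rw [← Finset.sum_range_reflect (fun p => (g (p + 1) - g p) ^ 2)]
    refine Finset.sum_congr rfl fun p hp => ?_
    have hp' := Finset.mem_range.1 hp
    rw [show m - 1 - p + 1 = m - p by omega, show m - 1 - p = m - (p + 1) by omega]
    ring
  have e3 : ∑ p ∈ Finset.range (m + r + 1), (g p - g m) ^ 2 ≤
      ∑ p ∈ Finset.range (m + 1), (g p - g m) ^ 2 +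
        ∑ p ∈ Finset.range (r + 1), (g (m + p) - g m) ^ 2 := by
    rw [add_assoc, Finset.sum_range_add, Finset.sum_range_succ _ m]
    simp
  have e4 : ∑ p ∈ Finset.range r, (g (m + (p + 1)) - g m - (g (m + p) - g m)) ^ 2 =
      ∑ p ∈ Finset.range r, (g (m + p + 1) - g (m + p)) ^ 2 :=
    Finset.sum_congr rfl fun p _ => by rw [← add_assoc]; ring
  rw [e1, e2] at hl
  rw [e4] at hr'
  refine e3.trans ((add_le_add hl hr').trans ?_)
  rw [Finset.sum_range_add, mul_add K]
  exact add_le_add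
    (mul_le_mul_of_nonneg_right hm (Finset.sum_nonneg fun _ _ => sq_nonneg _))
    (mul_le_mul_of_nonneg_right hr (Finset.sum_nonneg fun _ _ => sq_nonneg _))

/-- Poincaré inequality on a path for functions vanishing at every `n`-th point. -/
theorem sum_sq_le_of_periodic_zeros (g : ℕ → ℝ) (n k : ℕ) (hg : ∀ q < k, g (q * n) = 0) :
    ∑ p ∈ Finset.range (k * n), g p ^ 2 ≤
      (n : ℝ) ^ 2 / 2 * ∑ p ∈ Finset.range (k * n), (g (p + 1) - g p) ^ 2 := by
  induction k with
  | zero => simp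
  | succ k ih =>
    rw [add_mul, one_mul, Finset.sum_range_add, Finset.sum_range_add, mul_add]
    refine add_le_add (ih fun q hq => hg q (by omega)) ?_
    rcases n with _ | n
    · simp
    have := sum_sq_le_of_eq_zero (fun p => g (k * (n + 1) + p)) (by simpa using hg k (by omega)) n
    refine this.trans ?_
    rw [Finset.sum_range_succ _ n]
    refine mul_le_mul ?_ ?_ (Finset.sum_nonneg fun _ _ => sq_nonneg _) (by positivity)
    · push_cast
      nlinarith [(Nat.cast_nonneg n : (0 : ℝ) ≤ n)]
    · exact le_add_of_nonneg_right (sq_nonneg _)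

/-- Nonnegative increments have superadditive squares: an edge that jumps over several path steps
carries at least their total energy. -/
theorem sum_Ico_sq_sub_le (g : ℕ → ℝ) (hg : Monotone g) {a b : ℕ} (hab : a ≤ b) :
    ∑ l ∈ Finset.Ico a b, (g (l + 1) - g l) ^ 2 ≤ (g b - g a) ^ 2 := by
  refine (Finset.sum_sq_le_sq_sum_of_nonneg fun l _ => sub_nonneg.2 (hg l.le_succ)).trans ?_
  rw [Finset.sum_Ico_sub g hab]

theorem exists_adj_of_connected {V : Type*} {G : SimpleGraph V} (hG : G.Connected) (S : Set V)
    (hS : S.Nonempty) (hS' : Sᶜ.Nonempty) : ∃ u ∈ S, ∃ v ∉ S, G.Adj u v := by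
  obtain ⟨x, hx⟩ := hS
  obtain ⟨y, hy⟩ := hS'
  obtain ⟨w⟩ := hG.preconnected x y
  obtain ⟨d, -, h1, h2⟩ := w.exists_boundary_dart S hx hy
  exact ⟨_, h1, _, h2, d.adj⟩

variable {V : Type*} [Fintype V] [DecidableEq V]

/-- Among all connected graphs, the energy of a function is smallest on the path that visits the
vertices in the order of the values of the function. -/
theorem two_mul_sum_sq_le_energy {G : SimpleGraph V} [DecidableRel G.Adj] (hG : G.Connected)
    (f : V → ℝ) (pos : V → ℕ) (g : ℕ → ℝ) (hg : Monotone g) (hf : ∀ v, f v = g (pos v)) (M : ℕ)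
    (hM : ∀ l < M, (∃ x, pos x ≤ l) ∧ ∃ y, l < pos y) :
    2 * ∑ l ∈ Finset.range M, (g (l + 1) - g l) ^ 2 ≤ energy G f := by
  -- The pair `i`, `j` is separated by the cut between positions `l` and `l + 1`.
  let sep : ℕ → V → V → Prop := fun l i j => pos i ≤ l ∧ l < pos j ∨ pos j ≤ l ∧ l < pos i
  have hsep : ∀ i j, ∑ l ∈ Finset.range M, (if sep l i j then (g (l + 1) - g l) ^ 2 else 0) ≤
      (f i - f j) ^ 2 := fun i j => by
    have h1 : (f i - f j) ^ 2 = (g (max (pos i) (pos j)) - g (min (pos i) (pos j))) ^ 2 := by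
      rw [hf, hf]
      rcases le_total (pos i) (pos j) with h | h
      · rw [max_eq_right h, min_eq_left h]; ring
      · rw [max_eq_left h, min_eq_right h]
    rw [h1]
    refine le_trans ?_ (sum_Ico_sq_sub_le g hg min_le_max)
    rw [← Finset.sum_filter]
    refine Finset.sum_le_sum_of_subset_of_nonneg (fun l hl => ?_) fun _ _ _ => sq_nonneg _
    have := (Finset.mem_filter.1 hl).2
    simp only [sep] at this
    simp only [Finset.mem_Ico]
    omega
  have h2 : ∑ i, ∑ j, (if G.Adj i j then ∑ l ∈ Finset.range M,
      (if sep l i j then (g (l + 1) - g l) ^ 2 else 0) else 0) ≤ energy G f := by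
    refine Finset.sum_le_sum fun i _ => Finset.sum_le_sum fun j _ => ?_
    split_ifs
    exacts [hsep i j, le_rfl]
  refine le_trans ?_ h2
  have h3 : ∀ i j, (if G.Adj i j then ∑ l ∈ Finset.range M,
      (if sep l i j then (g (l + 1) - g l) ^ 2 else 0) else 0) = ∑ l ∈ Finset.range M,
      (if G.Adj i j ∧ sep l i j then (g (l + 1) - g l) ^ 2 else 0) := fun i j => by
    by_cases h : G.Adj i j <;> simp [h]
  simp only [h3, ← Fintype.sum_prod_type']
  rw [Finset.sum_comm, Finset.mul_sum]
  refine Finset.sum_le_sum fun l hl => ?_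
  obtain ⟨⟨x, hx⟩, y, hy⟩ := hM l (Finset.mem_range.1 hl)
  -- Some edge crosses each cut; its two orientations give the factor `2`.
  obtain ⟨u, hu, v, hv, huv⟩ := exists_adj_of_connected hG {w | pos w ≤ l} ⟨x, hx⟩
    ⟨y, by simpa using hy⟩
  simp only [Set.mem_ofPred_eq, not_le] at hu hv
  have hne : ((u, v) : V × V) ≠ (v, u) := fun h => huv.ne (Prod.ext_iff.1 h).1
  refine le_trans ?_ (Finset.sum_le_univ_sum_of_nonneg (s := {(u, v), (v, u)}) fun p => ?_)
  · rw [Finset.sum_pair hne, if_pos ⟨huv, Or.inl ⟨hu, hv⟩⟩, if_pos ⟨huv.symm, Or.inr ⟨hu, hv⟩⟩,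
      two_mul]
  · split_ifs
    exacts [sq_nonneg _, le_rfl]

/-- The spectral gap of a connected graph on `N` vertices is at least `4 / N ^ 2`. -/
theorem sum_sq_le_energy_of_sum_eq_zero {G : SimpleGraph V} [DecidableRel G.Adj]
    (hG : G.Connected) (hN : 2 ≤ Fintype.card V) (f : V → ℝ) (hf : ∑ v, f v = 0) :
    2 * (4 / (Fintype.card V : ℝ) ^ 2) * ∑ v, f v ^ 2 ≤ energy G f := by
  set N := Fintype.card V with hNdef
  let e := Fintype.equivFin V
  let σ : Fin N ≃ V := (Tuple.sort (f ∘ e.symm)).trans e.symm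
  have hσ : Monotone (f ∘ σ) := Tuple.monotone_sort (f ∘ e.symm)
  -- Clamping the index extends the sorted values to a monotone function on `ℕ`.
  let g : ℕ → ℝ := fun p => f (σ ⟨min p (N - 1), by omega⟩)
  have hg : Monotone g := fun p q hpq => hσ (Fin.le_def.2 (by simp only; omega))
  have hgσ : ∀ p : Fin N, g p = f (σ p) := fun p => by
    simp only [g]
    congr
    omega
  have hpath := two_mul_sum_sq_le_energy hG f (fun v => σ.symm v) g hg
    (fun v => by rw [hgσ]; simp) (N - 1) fun l hl => by
      refine ⟨⟨σ ⟨0, by omega⟩, by simp⟩, σ ⟨N - 1, by omega⟩, by simpa using hl⟩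
  have hsum : ∀ φ : ℝ → ℝ, ∑ v, φ (f v) = ∑ p ∈ Finset.range N, φ (g p) := fun φ => by
    rw [← Fin.sum_univ_eq_sum_range (fun p => φ (g p)), ← Equiv.sum_comp σ]
    simp only [hgσ]
  -- Centring at the median value leaves at most `N / 2` steps on either side; `m (m + 1) / 2 ≤ N² /
  -- 4` then needs `N ≥ 2`.
  obtain ⟨m, r, hmr, hm, hr⟩ : ∃ m r, N = m + r + 1 ∧ 2 * m ≤ N ∧ 2 * r ≤ N :=
    ⟨N / 2, N - 1 - N / 2, by omega, by omega, by omega⟩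
  have hN2 : (2 : ℝ) ≤ N := by exact_mod_cast hN
  have hm' : 2 * (m : ℝ) ≤ N := by exact_mod_cast hm
  have hr' : 2 * (r : ℝ) ≤ N := by exact_mod_cast hr
  have hp := sum_sq_sub_le g m r ((N : ℝ) ^ 2 / 4)
    (by nlinarith [(Nat.cast_nonneg m : (0 : ℝ) ≤ m)])
    (by nlinarith [(Nat.cast_nonneg r : (0 : ℝ) ≤ r)])
  rw [← hmr, show m + r = N - 1 by omega, ← hsum fun x => (x - g m) ^ 2] at hp
  -- The mean, here zero, minimises the sum of squared deviations.
  have hvar : ∑ v, f v ^ 2 ≤ ∑ v, (f v - g m) ^ 2 := by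
    have : ∑ v, (f v - g m) ^ 2 = ∑ v, f v ^ 2 + N * g m ^ 2 := by
      have h1 : ∀ v, (f v - g m) ^ 2 = f v ^ 2 - 2 * g m * f v + g m ^ 2 := fun v => by ring
      simp only [h1, Finset.sum_add_distrib, Finset.sum_sub_distrib, ← Finset.mul_sum, hf]
      simp [hNdef]
    rw [this]
    have : 0 ≤ (N : ℝ) * g m ^ 2 := by positivity
    linarith
  refine le_trans ?_ hpath
  have h4 : 2 * (4 / (N : ℝ) ^ 2) * ((N : ℝ) ^ 2 / 4) = 2 := by
    field_simp
  calc 2 * (4 / (N : ℝ) ^ 2) * ∑ v, f v ^ 2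
      ≤ 2 * (4 / (N : ℝ) ^ 2) * ((N : ℝ) ^ 2 / 4 *
          ∑ p ∈ Finset.range (N - 1), (g (p + 1) - g p) ^ 2) := by
        gcongr
        exact hvar.trans hp
    _ = _ := by rw [← mul_assoc, h4]

end RRW

/-! ### Tours and quadratic growth of the spectrum. -/

namespace RRW

/-- The energy of `f` along the walk through `a :: l`. -/
def walkEnergy {V : Type*} (f : V → ℝ) : V → List V → ℝ
  | _, [] => 0
  | a, b :: l => (f b - f a) ^ 2 + walkEnergy f b l

/-- The position at time `p` of the walk through `a :: l`, which stays at its last vertex. -/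
def walkAt {V : Type*} : V → List V → ℕ → V
  | a, [], _ => a
  | a, _ :: _, 0 => a
  | _, b :: l, p + 1 => walkAt b l p

theorem walkAt_zero {V : Type*} (a : V) (l : List V) : walkAt a l 0 = a := by
  cases l <;> rfl

/-- Resting at the last vertex costs no energy, so `K` may exceed the length of the walk. -/
theorem sum_walkAt_le {V : Type*} (f : V → ℝ) (a : V) (l : List V) (K : ℕ) :
    ∑ p ∈ Finset.range K, (f (walkAt a l (p + 1)) - f (walkAt a l p)) ^ 2 ≤
      walkEnergy f a l := by
  induction l generalizing a K with
  | nil => simp [walkAt, walkEnergy]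
  | cons b l ih =>
    rcases K with _ | K
    · refine add_nonneg (sq_nonneg _) ?_
      simpa using ih b 0
    · rw [Finset.sum_range_succ', walkEnergy, add_comm]
      simp only [walkAt, walkAt_zero]
      exact add_le_add le_rfl (ih b K)

theorem exists_walkAt_eq {V : Type*} (a : V) (l : List V) {v : V} (hv : v ∈ a :: l) :
    ∃ p < l.length + 1, walkAt a l p = v := by
  induction l generalizing a with
  | nil => exact ⟨0, by simp, by simpa [walkAt, eq_comm] using hv⟩
  | cons b l ih =>
    rcases List.mem_cons.1 hv with rfl | hv
    · exact ⟨0, by simp, rfl⟩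
    · obtain ⟨p, hp, h⟩ := ih b hv
      exact ⟨p + 1, by simpa using hp, h⟩

/-- A walk through `u` can be extended by an excursion from `u` to `v` and back. -/
theorem exists_excursion {V : Type*} (a : V) (l : List V) {u : V} (hu : u ∈ a :: l) (v : V) :
    ∃ l', l'.length = l.length + 2 ∧ (∀ x, x ∈ a :: l' ↔ x = v ∨ x ∈ a :: l) ∧
      ∀ f : V → ℝ, walkEnergy f a l' = walkEnergy f a l + 2 * (f u - f v) ^ 2 := by
  induction l generalizing a with
  | nil =>
    obtain rfl : u = a := by simpa using hu
    refine ⟨[v, u], rfl, fun x => ?_, fun f => ?_⟩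
    · simp only [List.mem_cons]; tauto
    · simp only [walkEnergy]; ring
  | cons b l ih =>
    rcases List.mem_cons.1 hu with rfl | hu
    · refine ⟨v :: u :: b :: l, rfl, fun x => ?_, fun f => ?_⟩
      · simp only [List.mem_cons]; tauto
      · simp only [walkEnergy]; ring
    · obtain ⟨l', h1, h2, h3⟩ := ih b hu
      refine ⟨b :: l', by simp [h1], fun x => ?_, fun f => ?_⟩
      · rw [List.mem_cons, h2, List.mem_cons (a := x) (b := a) (l := b :: l)]; tauto
      · simp only [walkEnergy, h3]; ring

variable {V : Type*} [Fintype V] [DecidableEq V]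

/-- A connected graph has a closed tour through all vertices that uses every edge at most twice. -/
theorem exists_tour {G : SimpleGraph V} [DecidableRel G.Adj] (hG : G.Connected) :
    ∃ a l, l.length + 1 < 2 * Fintype.card V ∧ (∀ v, v ∈ a :: l) ∧
      ∀ f, walkEnergy f a l ≤ energy G f := by
  obtain ⟨a⟩ := hG.nonempty
  -- Grow the visited set `S` one vertex at a time. The excursion to a new neighbour adds two steps
  -- and `2 (f u - f v)²`, which both orientations of that edge pay for.
  have key : ∀ m < Fintype.card V, ∃ l : List V, ∃ S : Finset V, l.length = 2 * m ∧
      S.card = m + 1 ∧ (∀ x, x ∈ a :: l ↔ x ∈ S) ∧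
      ∀ f : V → ℝ, walkEnergy f a l ≤
        ∑ i ∈ S, ∑ j ∈ S, if G.Adj i j then (f i - f j) ^ 2 else 0 := by
    intro m
    induction m with
    | zero => exact fun _ => ⟨[], {a}, rfl, by simp, by simp, by simp [walkEnergy]⟩
    | succ m ih =>
      intro hm
      obtain ⟨l, S, h1, h2, h3, h4⟩ := ih (by omega)
      obtain ⟨y, hy⟩ : ∃ y, y ∉ S := by
        by_contra! h
        rw [Finset.eq_univ_of_forall h, Finset.card_univ] at h2
        omega
      obtain ⟨u, hu, v, hv, huv⟩ := exists_adj_of_connected hG (S : Set V)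
        ⟨a, by simpa using (h3 a).1 (by simp)⟩ ⟨y, by simpa using hy⟩
      simp only [Finset.mem_coe] at hu hv
      obtain ⟨l', k1, k2, k3⟩ := exists_excursion a l ((h3 u).2 hu) v
      refine ⟨l', insert v S, by omega, by rw [Finset.card_insert_of_notMem hv, h2],
        fun x => by rw [k2, h3, Finset.mem_insert], fun f => ?_⟩
      rw [k3, Finset.sum_insert hv]
      simp only [Finset.sum_insert hv, Finset.sum_add_distrib]
      have hle : (f u - f v) ^ 2 ≤ ∑ i ∈ S, if G.Adj i v then (f i - f v) ^ 2 else 0 := by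
        refine le_trans ?_ (Finset.single_le_sum (fun i _ => ?_) hu)
        · rw [if_pos huv]
        · split_ifs
          exacts [sq_nonneg _, le_rfl]
      have heq : (∑ j ∈ S, if G.Adj v j then (f v - f j) ^ 2 else 0) =
          ∑ i ∈ S, if G.Adj i v then (f i - f v) ^ 2 else 0 :=
        Finset.sum_congr rfl fun i _ => by
          simp only [G.adj_comm v i, sub_sq_comm (f v)]
      rw [heq]
      simp only [SimpleGraph.irrefl, if_false, zero_add]
      linarith [h4 f]
  have hpos := Fintype.card_pos_iff.2 ⟨a⟩
  obtain ⟨l, S, h1, h2, h3, h4⟩ := key (Fintype.card V - 1) (by omega)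
  have hS : S = Finset.univ := Finset.eq_univ_of_card S (by omega)
  subst hS
  exact ⟨a, l, by omega, fun v => (h3 v).2 (Finset.mem_univ v), h4⟩

/-- On a subspace of codimension at most `k`, the energy is bounded below with a constant that
grows quadratically in `k`. -/
theorem exists_linearMap_sum_sq_le_energy {G : SimpleGraph V} [DecidableRel G.Adj]
    (hG : G.Connected) (k : ℕ) (hk : 0 < k) (hkN : k ≤ Fintype.card V) :
    ∃ W : (V → ℝ) →ₗ[ℝ] (Fin k → ℝ), ∀ f, W f = 0 →
      2 * ((k : ℝ) ^ 2 / (9 * (Fintype.card V : ℝ) ^ 2)) * ∑ v, f v ^ 2 ≤ energy G f := by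
  obtain ⟨a, l, hl, hmem, hE⟩ := exists_tour hG
  set N := Fintype.card V
  -- `k` blocks of length `n` cover the tour, while `n k ≤ 3 N` because `k ≤ N`; this is the source
  -- of the `9`.
  set n := 2 * N / k + 1 with hn
  have hkn : 2 * N ≤ k * n := by
    rw [hn]
    have := Nat.lt_mul_div_succ (2 * N) hk
    omega
  refine ⟨LinearMap.funLeft ℝ ℝ fun q : Fin k => walkAt a l (q * n), fun f hf => ?_⟩
  have h0 : ∀ q < k, f (walkAt a l (q * n)) = 0 := fun q hq => congrFun hf ⟨q, hq⟩
  have h1 := sum_sq_le_of_periodic_zeros (fun p => f (walkAt a l p)) n k h0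
  have h2 := (sum_walkAt_le f a l (k * n)).trans (hE f)
  have h3 : ∑ v, f v ^ 2 ≤ ∑ p ∈ Finset.range (k * n), f (walkAt a l p) ^ 2 := by
    choose p hp hw using fun v => exists_walkAt_eq a l (hmem v)
    have hinj : Function.Injective p := fun x y h => by rw [← hw x, ← hw y, h]
    calc ∑ v, f v ^ 2 = ∑ v, f (walkAt a l (p v)) ^ 2 := by simp only [hw]
      _ = ∑ q ∈ Finset.univ.image p, f (walkAt a l q) ^ 2 :=
        (Finset.sum_image (f := fun q => f (walkAt a l q) ^ 2) hinj.injOn).symm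
      _ ≤ _ := by
        refine Finset.sum_le_sum_of_subset_of_nonneg (fun q hq => ?_) fun _ _ _ => sq_nonneg _
        obtain ⟨v, -, rfl⟩ := Finset.mem_image.1 hq
        have := hp v
        simp only [Finset.mem_range]
        omega
  have hk' : (0 : ℝ) < k := by exact_mod_cast hk
  have hkN' : (k : ℝ) ≤ N := by exact_mod_cast hkN
  have h4 : (n : ℝ) * k ≤ 3 * N := by
    have : n * k ≤ 3 * N := by
      rw [hn, add_mul, one_mul]
      have := Nat.div_mul_le_self (2 * N) k
      omega
    exact_mod_cast this
  have hN : (0 : ℝ) < N := hk'.trans_le hkN'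
  have hE0 : 0 ≤ energy G f := le_trans (Finset.sum_nonneg fun _ _ => sq_nonneg _) h2
  have h5 : ∑ v, f v ^ 2 ≤ (n : ℝ) ^ 2 / 2 * energy G f :=
    h3.trans (h1.trans (mul_le_mul_of_nonneg_left h2 (by positivity)))
  have h6 : ((n : ℝ) * k) ^ 2 ≤ (3 * N) ^ 2 := by gcongr
  calc 2 * ((k : ℝ) ^ 2 / (9 * (N : ℝ) ^ 2)) * ∑ v, f v ^ 2
      ≤ 2 * ((k : ℝ) ^ 2 / (9 * (N : ℝ) ^ 2)) * ((n : ℝ) ^ 2 / 2 * energy G f) := by gcongr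
    _ = ((n : ℝ) * k) ^ 2 / (3 * N) ^ 2 * energy G f := by field_simp; ring
    _ ≤ 1 * energy G f := by
        gcongr
        exact div_le_one_of_le₀ h6 (by positivity)
    _ = _ := one_mul _

end RRW

/-! ### Summing the exponentials. -/

namespace RRW

open Real in
theorem sum_exp_neg_mul_sq_le {b : ℝ} (hb : 0 < b) (n : ℕ) :
    ∑ j ∈ Finset.range n, exp (-b * ((j + 1 : ℕ) : ℝ) ^ 2) ≤ √(π / b) / 2 := by
  have hanti : AntitoneOn (fun x : ℝ => exp (-b * x ^ 2)) (Set.Icc 0 (0 + n)) := by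
    intro x hx y _ hxy
    have : x ^ 2 ≤ y ^ 2 := pow_le_pow_left₀ hx.1 hxy 2
    exact exp_le_exp.2 (by nlinarith)
  have h1 := hanti.sum_le_integral
  simp only [zero_add] at h1
  refine h1.trans ?_
  rw [← integral_gaussian_Ioi, intervalIntegral.integral_of_le (Nat.cast_nonneg n)]
  exact MeasureTheory.setIntegral_mono_set (integrable_exp_neg_mul_sq hb).integrableOn
    (Filter.Eventually.of_forall fun x => (exp_pos _).le)
    (Filter.Eventually.of_forall Set.Ioc_subset_Ioi_self)

variable {V : Type*} [Fintype V] [DecidableEq V]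

theorem eigenvalues₀_zero_le (G : SimpleGraph V) [DecidableRel G.Adj] (hδ : 0 < G.maxDegree)
    (h0 : 0 < Fintype.card V) : (isHermitian_transition G hδ).eigenvalues₀ ⟨0, h0⟩ ≤ 1 := by
  have := eigenvalues₀_le_of_energy G hδ ⟨0, h0⟩ 0 0 fun f _ => by
    rw [mul_zero, zero_mul]
    refine Finset.sum_nonneg fun i _ => Finset.sum_nonneg fun j _ => ?_
    split_ifs
    exacts [sq_nonneg _, le_rfl]
  simpa using this

/-- The single constraint `∑ f = 0` bounds the eigenvalue of index `1`, hence all later ones by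
monotonicity. -/
theorem eigenvalues₀_le_gap {G : SimpleGraph V} [DecidableRel G.Adj] (hG : G.Connected)
    (hδ : 0 < G.maxDegree) (k : Fin (Fintype.card V)) (hk : 0 < (k : ℕ)) :
    (isHermitian_transition G hδ).eigenvalues₀ k ≤
      1 - 4 / (Fintype.card V : ℝ) ^ 2 / G.maxDegree := by
  have hN : 1 < Fintype.card V := by omega
  refine ((isHermitian_transition G hδ).eigenvalues₀_antitone
    (show (⟨1, hN⟩ : Fin (Fintype.card V)) ≤ k from Fin.le_def.2 hk)).trans ?_
  refine eigenvalues₀_le_of_energy G hδ ⟨1, hN⟩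
    (LinearMap.pi fun _ => ∑ v, LinearMap.proj v) _ fun f hf => ?_
  refine sum_sq_le_energy_of_sum_eq_zero hG hN f ?_
  simpa using congrFun hf ⟨0, Nat.one_pos⟩

theorem eigenvalues₀_le_quadratic {G : SimpleGraph V} [DecidableRel G.Adj] (hG : G.Connected)
    (hδ : 0 < G.maxDegree) (k : Fin (Fintype.card V)) (hk : 0 < (k : ℕ)) :
    (isHermitian_transition G hδ).eigenvalues₀ k ≤
      1 - (k : ℝ) ^ 2 / (9 * (Fintype.card V : ℝ) ^ 2) / G.maxDegree := by
  obtain ⟨W, hW⟩ := exists_linearMap_sum_sq_le_energy hG k hk k.2.le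
  exact eigenvalues₀_le_of_energy G hδ k W _ hW

open Real in
/-- A return probability bound of the order `1 / N + 1 / √t`, with exponential decay on the time
scale of the spectral gap. -/
theorem averageReturnProb_le {G : SimpleGraph V} [DecidableRel G.Adj] (hG : G.Connected)
    (hδ : 0 < G.maxDegree) {t : ℝ} (ht : 0 < t) :
    averageReturnProb G t ≤ 1 / (Fintype.card V : ℝ) * (1 +
      exp (-(4 * t) / (G.maxDegree * (Fintype.card V : ℝ) ^ 2)) *
        (6 + 3 / 2 * √(π * G.maxDegree) * (Fintype.card V / √t))) := by
  have hA := isHermitian_transition G hδ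
  rw [averageReturnProb_eq_sum_exp G hδ hA]
  have hNpos : 0 < Fintype.card V := Fintype.card_pos_iff.2 hG.nonempty
  have hδ' : (0 : ℝ) < G.maxDegree := by exact_mod_cast hδ
  have hN' : (0 : ℝ) < Fintype.card V := by exact_mod_cast hNpos
  have hgap := eigenvalues₀_le_gap hG hδ
  have hquad := eigenvalues₀_le_quadratic hG hδ
  have hzero := eigenvalues₀_zero_le G hδ hNpos
  set N := Fintype.card V
  set δ := G.maxDegree
  set s := 4 * t / (δ * (N : ℝ) ^ 2) with hs
  have hs0 : 0 < s := by positivity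
  -- Truncated subtraction merges both bounds: for `1 ≤ k ≤ 6` only the gap factor `exp (-s)`
  -- remains, and for `k ≥ 6` one has `k² ≥ 36 + (k - 6)²`.
  let F : ℕ → ℝ := fun k =>
    if k = 0 then 1 else exp (-s) * exp (-(s / 36) * ((k - 6 : ℕ) : ℝ) ^ 2)
  have hF : ∀ k : Fin N, exp (-(t * (1 - hA.eigenvalues₀ k))) ≤ F k := fun k => by
    rcases Nat.eq_zero_or_pos k with hk | hk
    · have hk' : k = ⟨0, hNpos⟩ := Fin.ext hk
      simp only [F, hk, if_true]
      rw [exp_le_one_iff, hk']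
      have : 0 ≤ t * (1 - hA.eigenvalues₀ ⟨0, hNpos⟩) := mul_nonneg ht.le (sub_nonneg.2 hzero)
      linarith
    · simp only [F, hk.ne', if_false]
      rw [← exp_add, exp_le_exp]
      rcases le_total (k : ℕ) 6 with h6 | h6
      · have h1 := mul_le_mul_of_nonneg_left (hgap k hk) ht.le
        have h2 : t * (4 / (N : ℝ) ^ 2 / δ) = s := by rw [hs]; field_simp
        rw [Nat.sub_eq_zero_of_le h6]
        push_cast
        linarith
      · have h1 := mul_le_mul_of_nonneg_left (hquad k hk) ht.le
        have h2 : t * ((k : ℝ) ^ 2 / (9 * (N : ℝ) ^ 2) / δ) = s / 36 * (k : ℝ) ^ 2 := by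
          rw [hs]; field_simp; ring
        have h3 : (6 : ℝ) ≤ k := by exact_mod_cast h6
        rw [Nat.cast_sub h6]
        push_cast
        nlinarith [mul_nonneg hs0.le (sub_nonneg.2 h3)]
  have hFpos : ∀ k, 0 ≤ F k := fun k => by
    simp only [F]; split_ifs <;> positivity
  have hsum : ∑ k : Fin N, exp (-(t * (1 - hA.eigenvalues₀ k))) ≤
      1 + exp (-s) * (6 + ∑ j ∈ Finset.range N, exp (-(s / 36) * ((j + 1 : ℕ) : ℝ) ^ 2)) := by
    calc _ ≤ ∑ k : Fin N, F k := Finset.sum_le_sum fun k _ => hF k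
      _ = ∑ k ∈ Finset.range N, F k := Fin.sum_univ_eq_sum_range F N
      -- The first seven indices contribute `1` and `6 exp (-s)`; the rest form the Gaussian sum.
      _ ≤ ∑ k ∈ Finset.range (7 + N), F k :=
        Finset.sum_le_sum_of_subset_of_nonneg (Finset.range_mono (by omega)) fun k _ _ => hFpos k
      _ = _ := by
        rw [Finset.sum_range_add]
        have h1 : ∀ j : ℕ, F (7 + j) =
            exp (-s) * exp (-(s / 36) * ((j + 1 : ℕ) : ℝ) ^ 2) := fun j => by
          simp only [F, show 7 + j ≠ 0 by omega, if_false, show 7 + j - 6 = j + 1 by omega]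
        simp only [h1, ← Finset.mul_sum]
        simp [F, Finset.sum_range_succ]
        ring
  have hgauss : √(π / (s / 36)) / 2 = 3 / 2 * √(π * δ) * (N / √t) := by
    have h1 : π / (s / 36) = (3 * N) ^ 2 * (π * δ) / t := by
      rw [hs]; field_simp; ring
    rw [h1, sqrt_div' _ ht.le, sqrt_mul (by positivity), sqrt_sq (by positivity)]
    ring
  have hle := hgauss ▸ sum_exp_neg_mul_sq_le (b := s / 36) (by positivity) N
  rw [show -(4 * t) / (δ * (N : ℝ) ^ 2) = -s by rw [hs]; ring]
  refine mul_le_mul_of_nonneg_left (hsum.trans ?_) (by positivity)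
  gcongr

/-! ### Comparison in the admissible range of times. -/

open Real in
/-- The lower bounds on `N ^ 2 / √t` in the admissible range of times. -/
theorem time_range_bounds {N ν t : ℝ} (hN : 1 ≤ N) (hν : 0 < ν) (hν' : ν ≤ 1 / 5)
    (h1 : (4 : ℝ) ^ (1 + ν) * N ^ (1 - ν) ≤ t)
    (h2 : t ≤ (4 : ℝ) ^ (-((1 + ν) ^ 2 / ν)) * N ^ 4) :
    1 ≤ t ∧ 6 ≤ N * (N ^ (1 - ν) / √t) ^ (1 / (1 + ν)) ∧
      3 * (N / √t) ≤ N * (N ^ (1 - ν) / √t) ^ (1 / (1 + ν)) := by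
  have hN0 : 0 < N := by linarith
  have hν1 : 0 < 1 + ν := by linarith
  have ht1 : 1 ≤ t := by
    refine le_trans ?_ h1
    exact one_le_mul_of_one_le_of_one_le (one_le_rpow (by norm_num) (by linarith))
      (one_le_rpow hN (by linarith))
  have ht : 0 < t := by linarith
  have hst : 0 < √t := sqrt_pos.2 ht
  have hst1 : 1 ≤ √t := one_le_sqrt.2 ht1
  set e := (1 + ν) ^ 2 / ν with he
  have hνinv : 5 ≤ 1 / ν := by rw [le_div_iff₀ hν]; linarith
  have he' : e / (1 + ν) = 1 / ν + 1 := by rw [he]; field_simp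
  have he5 : 5 ≤ e := by
    have : e = 1 / ν + 2 + ν := by rw [he]; field_simp; ring
    linarith
  have hR : N * (N ^ (1 - ν) / √t) ^ (1 / (1 + ν)) = (N ^ 2 / √t) ^ (1 / (1 + ν)) := by
    have h3 : N = (N ^ (1 + ν)) ^ (1 / (1 + ν)) := by
      rw [← rpow_mul hN0.le, mul_one_div_cancel hν1.ne', rpow_one]
    conv_lhs => enter [1]; rw [h3]
    rw [← mul_rpow (by positivity) (by positivity), ← mul_div_assoc, ← rpow_add hN0]
    norm_num
  have h4 : (4 : ℝ) ^ (-e) = ((2 : ℝ) ^ (-e)) ^ 2 := by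
    rw [← rpow_natCast, ← rpow_mul (by norm_num), mul_comm, rpow_mul (by norm_num)]
    norm_num
  have hsqrt : √t ≤ (2 : ℝ) ^ (-e) * N ^ 2 := by
    rw [sqrt_le_iff]
    refine ⟨by positivity, h2.trans_eq ?_⟩
    rw [h4]; ring
  -- This is the upper limit on `t`, rewritten. As `e / (1 + ν) = 1 / ν + 1 ≥ 6`, it leaves ample
  -- room for the bound `6`.
  have hbig : (2 : ℝ) ^ e ≤ N ^ 2 / √t := by
    rw [le_div_iff₀ hst]
    calc (2 : ℝ) ^ e * √t ≤ 2 ^ e * (2 ^ (-e) * N ^ 2) := by gcongr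
      _ = N ^ 2 := by rw [← mul_assoc, ← rpow_add (by norm_num)]; simp
  rw [hR]
  refine ⟨ht1, ?_, ?_⟩
  · calc (6 : ℝ) ≤ 2 ^ (3 : ℝ) := by norm_num
      _ ≤ 2 ^ (e / (1 + ν)) := rpow_le_rpow_of_exponent_le (by norm_num) (by rw [he']; linarith)
      _ = (2 ^ e) ^ (1 / (1 + ν)) := by rw [← rpow_mul (by norm_num)]; ring_nf
      _ ≤ _ := rpow_le_rpow (by positivity) hbig (by positivity)
  · have hN4 : 729 ≤ N ^ 4 := by
      have h5 : (2 : ℝ) ^ (5 : ℝ) ≤ N ^ 2 := by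
        refine (rpow_le_rpow_of_exponent_le (by norm_num) he5).trans (hbig.trans ?_)
        exact div_le_self (by positivity) hst1
      norm_num at h5
      nlinarith
    set y := N / √t with hy
    have hy0 : 0 < y := by positivity
    have hyN : y ≤ N := div_le_self hN0.le hst1
    -- Since `N² / √t = N y`, this is `3 y ≤ (N y)^(1/(1+ν))` raised to the power `1 + ν` and
    -- divided by `y`. With `y ≤ N` and `ν ≤ 1/5` it reduces to `729 ≤ N⁴`.
    have hexp : 3 ^ (1 + ν) * y ^ ν ≤ N := by
      calc (3 : ℝ) ^ (1 + ν) * y ^ ν ≤ 3 ^ (6 / 5 : ℝ) * N ^ (1 / 5 : ℝ) := by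
            refine mul_le_mul (rpow_le_rpow_of_exponent_le (by norm_num) (by linarith)) ?_
              (by positivity) (by positivity)
            exact (rpow_le_rpow hy0.le hyN hν.le).trans (rpow_le_rpow_of_exponent_le hN hν')
        _ = (729 * N) ^ (1 / 5 : ℝ) := by
            rw [mul_rpow (by norm_num) hN0.le, show (729 : ℝ) = 3 ^ (6 : ℝ) by norm_num,
              ← rpow_mul (by norm_num)]
            norm_num
        _ ≤ (N ^ (5 : ℝ)) ^ (1 / 5 : ℝ) := by
            refine rpow_le_rpow (by positivity) ?_ (by norm_num)
            calc 729 * N ≤ N ^ 4 * N := by gcongr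
              _ = N ^ (5 : ℝ) := by norm_cast
        _ = N := by rw [← rpow_mul hN0.le]; norm_num
    calc 3 * y = ((3 * y) ^ (1 + ν)) ^ (1 / (1 + ν)) := by
          rw [← rpow_mul (by positivity), mul_one_div_cancel hν1.ne', rpow_one]
      _ ≤ (N ^ 2 / √t) ^ (1 / (1 + ν)) := by
          refine rpow_le_rpow (by positivity) ?_ (by positivity)
          calc (3 * y) ^ (1 + ν) = 3 ^ (1 + ν) * y ^ ν * y := by
                rw [mul_rpow (by norm_num) hy0.le, rpow_add hy0, rpow_one]; ring
            _ ≤ N * y := by gcongr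
            _ = N ^ 2 / √t := by rw [hy]; ring

end RRW

theorem theorem1p2 {V : Type*} [Fintype V] [DecidableEq V] (G : SimpleGraph V)
    [DecidableRel G.Adj] (hconn : G.Connected)
    (δ : ℕ) (hδ : G.maxDegree = δ) (hδ3 : 3 ≤ δ)
    (N : ℕ) (hN : Fintype.card V = N)
    (ν : ℝ) (hν : ν = 1 / (((δ : ℝ) - 1) * Real.log 16))
    (a : ℝ) (ha : a = 1 + Real.sqrt (Real.pi * (δ : ℝ)) / (2 : ℝ) ^ (1 - ν))
    (t : ℝ) (ht_lower : (4 : ℝ) ^ (1 + ν) * (N : ℝ) ^ (1 - ν) ≤ t)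
    (ht_upper : t ≤ (4 : ℝ) ^ (-((1 + ν) ^ 2 / ν)) * (N : ℝ) ^ 4) :
    RRW.averageReturnProb G t ≤
      1 / (N : ℝ) + a * ((N : ℝ) ^ (1 - ν) / Real.sqrt t) ^ (1 / (1 + ν)) *
        Real.exp (-(4 * t) / ((δ : ℝ) * (N : ℝ) ^ 2)) := by
  subst hδ hN
  have hδ0 : 0 < G.maxDegree := by omega
  have hδ3' : (3 : ℝ) ≤ G.maxDegree := by exact_mod_cast hδ3
  have hN1 : (1 : ℝ) ≤ Fintype.card V := by
    exact_mod_cast Fintype.card_pos_iff.2 hconn.nonempty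
  have hlog : (5 : ℝ) / 2 ≤ Real.log 16 := by
    rw [show (16 : ℝ) = 2 ^ 4 by norm_num, Real.log_pow]
    have := Real.log_two_gt_d9
    push_cast
    linarith
  have hden : 5 ≤ ((G.maxDegree : ℝ) - 1) * Real.log 16 := by nlinarith
  have hν0 : 0 < ν := by rw [hν]; positivity
  have hν5 : ν ≤ 1 / 5 := by rw [hν]; exact one_div_le_one_div_of_le (by norm_num) hden
  obtain ⟨ht1, h6, h3⟩ := RRW.time_range_bounds hN1 hν0 hν5 ht_lower ht_upper
  refine (RRW.averageReturnProb_le hconn hδ0 (t := t) (by linarith)).trans ?_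
  set N : ℝ := (Fintype.card V : ℝ)
  set X := (N ^ (1 - ν) / Real.sqrt t) ^ (1 / (1 + ν))
  set E := Real.exp (-(4 * t) / ((G.maxDegree : ℝ) * N ^ 2))
  set P := Real.sqrt (Real.pi * (G.maxDegree : ℝ)) with hP
  have hN0 : 0 < N := by linarith
  have hpow : (2 : ℝ) ^ (1 - ν) ≤ 2 := by
    simpa using Real.rpow_le_rpow_of_exponent_le (x := 2) (by norm_num)
      (show 1 - ν ≤ 1 by linarith)
  -- The constant `a` splits accordingly: its `1` absorbs the `6`, its second term the Gaussian
  -- part.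
  have hP2 : P / 2 ≤ P / (2 : ℝ) ^ (1 - ν) := by gcongr
  have hmain : 6 + 3 / 2 * P * (N / Real.sqrt t) ≤ a * (N * X) := by
    have hP0 : 0 ≤ P := Real.sqrt_nonneg _
    calc 6 + 3 / 2 * P * (N / Real.sqrt t) = 6 + P / 2 * (3 * (N / Real.sqrt t)) := by ring
      _ ≤ N * X + P / (2 : ℝ) ^ (1 - ν) * (N * X) := by gcongr
      _ = a * (N * X) := by rw [ha]; ring
  calc 1 / N * (1 + E * (6 + 3 / 2 * P * (N / Real.sqrt t)))
      ≤ 1 / N * (1 + E * (a * (N * X))) := by gcongr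
    _ = 1 / N + a * X * E := by field_simp
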